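/- Identify $\mathbb{R}^2$ with $\mathbb{C}$. A \emph{mass} is a finite Borel measure $\mu$ on $\mathbb{R}^2$ that is absolutely continuous with respect to Lebesgue measure. For an integer $q\ge 2$, a point $c\in\mathbb{C}$ and $\lambda\in S^1$, let $$\mathcal{S}_{q,\lambda}(c)=\{c+\lambda v : v\in\mathbb{C},\ |\arg v|\le \pi/q\}$$ (with $v=0$ included) be the closed regular $q$-sector with apex $c$, angle $2\pi/q$ and central direction $\lambda$. Let $\varepsilon_\infty(q)$ denote the minimum of all real $\varepsilon$ such that for every mass $\mu$ there is a point $c$ with $$\bigl\|\mu(\mathcal{S}_{q,\lambda}(c))-\mu(\mathbb{R}^2)/q\bigr\|_\infty\le\varepsilon\,\mu(\mathbb{R}^2),$$ where $\|\cdot\|_\infty$ is the supremum norm of functions of $\lambda\in S^1$, and let $\varepsilon_2(q)$ be the analogous minimum with $\|\cdot\|_\infty$ replaced by the $L^2$-norm $\|f\|_2=\bigl(\frac1{2\pi}\int_{-\pi}^{\pi}|f(e^{i\theta})|^2\,d\theta\bigr)^{1/2}$. **Proposition 2.1.** (a) For every integer $q\ge 3$ the minimum $\varepsilon_\infty(q)$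 exists, and $$\varepsilon_\infty(q)=\max\left\{\frac1q,\ \frac{q-2}{2q}\right\}.$$ (b) For every integer $q\ge 2$ the minimum $\varepsilon_2(q)$ exists, and $$\varepsilon_2(q)\le\sqrt{\frac13-\frac{2}{\pi^2}-\frac{1}{3q^2}}.$$ Moreover, for $q=3$ and for all $q>6$, $$\sqrt{\frac13-\frac{2}{\pi^2}-\frac{1}{3q^2}}<\varepsilon_\infty(q).$$ -/

import Mathlib

open MeasureTheory

noncomputable section

/-- A mass on the plane (identified with `ℂ`): a finite Borel measure that is absolutely continuous
with respect to Lebesgue measure. -/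
structure IsMass (μ : Measure ℂ) : Prop where
  finite : IsFiniteMeasure μ
  absCont : μ ≪ (volume : Measure ℂ)

/-- The closed regular `q`-sector with apex `c` and central direction `z`: the points
`c + z * v` with `|arg v| ≤ π / q` (the apex `v = 0` is included). As `z` runs over the circle these
are all the regions of all regular `q`-fans centred at `c`. -/
def regularSector (q : ℕ) (c : ℂ) (z : Circle) : Set ℂ :=
  {u | ∃ v : ℂ, u = c + (z : ℂ) * v ∧ |v.arg| ≤ Real.pi / q}

/-- The function on the circle `z ↦ μ (S_{q,z}) - μ (ℂ) / q`, for the sectors centred at `c`. -/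
def sectorDeviation (q : ℕ) (μ : Measure ℂ) (c : ℂ) (z : Circle) : ℝ :=
  μ.real (regularSector q c z) - μ.real Set.univ / q

/-- The supremum norm of `sectorDeviation q μ c` over the circle. -/
def deviationSupNorm (q : ℕ) (μ : Measure ℂ) (c : ℂ) : ℝ :=
  ⨆ z : Circle, |sectorDeviation q μ c z|

/-- The `L²`-norm of `sectorDeviation q μ c` over the circle, with respect to normalized arc length
(the Haar probability measure). -/
def deviationL2Norm (q : ℕ) (μ : Measure ℂ) (c : ℂ) : ℝ :=
  √((2 * Real.pi)⁻¹ * ∫ θ in (-Real.pi)..Real.pi, (sectorDeviation q μ c (Circle.exp θ)) ^ 2)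

/-- The `ε` such that every planar mass has a centre whose regular `q`-sectors deviate from
equipartition by at most `ε` times the total mass, in the supremum norm. -/
def admissibleSup (q : ℕ) : Set ℝ :=
  {ε | ∀ μ : Measure ℂ, IsMass μ → ∃ c : ℂ, deviationSupNorm q μ c ≤ ε * μ.real Set.univ}

/-- The analogue of `admissibleSup` for the `L²`-norm. -/
def admissibleL2 (q : ℕ) : Set ℝ :=
  {ε | ∀ μ : Measure ℂ, IsMass μ → ∃ c : ℂ, deviationL2Norm q μ c ≤ ε * μ.real Set.univ}

/-- The optimal centre constant `ε_∞(q)`. -/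
def epsSup (q : ℕ) : ℝ := sInf (admissibleSup q)

/-- The optimal centre constant `ε_2(q)`. -/
def epsL2 (q : ℕ) : ℝ := sInf (admissibleL2 q)

end

/-!
The lower bounds for `ε_∞` come from two explicit families of masses. For two small discs of equal
mass, every centre is far from one of them, which then lies in a single sector
(`le_of_mem_admissibleSup`). For a thin rectangle, every centre has an almost empty sector with a
direction orthogonal to the long sides (`one_div_le_of_mem_admissibleSup`).

For the upper bounds, `0 ≤ μ (S)` gives one side. If `q ≥ 4`, a sector lies in one of the four
half-planes bounded by the axis-parallel lines through its apex, so the point whose coordinates are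
medians works (`exists_measureReal_regularSector_le_half`). If `q = 3`, a geometric median, that is
a minimizer of the total distance to the mass, works
(`exists_measureReal_regularSector_le_two_thirds`): the unit vectors from it towards the mass
average to zero (`exists_integral_dirCos_eq_zero`), so at most two thirds of them lie in a sector
of `120°`.

The geometric median also serves for `ε_2`. The deviation is an average, over the mass, of rotated
copies of the indicator function of an arc minus its mean, and at a geometric median the first
harmonic of that function contributes nothing and can be removed. By Cauchy–Schwarz and Fubini the
squared `L²`-norm is at most `1/q - 1/q² - 2 sin²(π/q) / π²` times the squared total mass
(`integral_sectorDeviation_sq_le`), which is at most the stated bound, with equality for `q = 2`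
(`variance_arcResidual_le`).

The minimum `ε_2` exists because the `L²`-norm attains its minimum over all centres
(`exists_forall_deviationL2Norm_le`): it is continuous in the centre, since the boundary of a sector
is a null set, and its limit at infinity is also an upper bound for all its values.
-/

open MeasureTheory Filter Topology

/-! ### Geometry of sectors -/

theorem measure_eq_zero_or_measureReal_univ_pos (μ : Measure ℂ) [IsFiniteMeasure μ] :
    μ = 0 ∨ 0 < μ.real Set.univ := by
  rcases eq_or_ne μ 0 with h | h
  · exact Or.inl h
  · right
    rw [measureReal_def]
    exact ENNReal.toReal_pos (by simpa using h) (measure_ne_top _ _)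

theorem IsMass.ae_ne {μ : Measure ℂ} (hμ : IsMass μ) (c : ℂ) : ∀ᵐ x ∂μ, x ≠ c :=
  measure_eq_zero_iff_ae_notMem.1 (hμ.absCont (by simp : volume {c} = 0))

theorem half_le_cos_pi_div {q : ℕ} (hq : 3 ≤ q) : 1 / 2 ≤ Real.cos (Real.pi / q) := by
  rw [← Real.cos_pi_div_three]
  have hq' : (3 : ℝ) ≤ q := by exact_mod_cast hq
  refine Real.cos_le_cos_of_nonneg_of_le_pi (by positivity) (by linarith [Real.pi_pos]) ?_
  gcongr

/-- A closed sector with angle at most `2π` is cut out by one inequality, which makes sense at the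
apex too and is jointly continuous in the point, the apex and the direction. -/
theorem mem_regularSector_iff {q : ℕ} (hq : 1 ≤ q) {c u : ℂ} {z : Circle} :
    u ∈ regularSector q c z ↔
      ‖u - c‖ * Real.cos (Real.pi / q) ≤ ((u - c) * (starRingEnd ℂ) (z : ℂ)).re := by
  have hz : (z : ℂ) * (starRingEnd ℂ) (z : ℂ) = 1 := by
    rw [Complex.mul_conj]; simp
  have key : u ∈ regularSector q c z ↔
      |((u - c) * (starRingEnd ℂ) (z : ℂ)).arg| ≤ Real.pi / q := by
    constructor
    · rintro ⟨v, rfl, hv⟩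
      have : (c + z * v - c) * (starRingEnd ℂ) (z : ℂ) = v := by
        linear_combination v * hz
      rwa [this]
    · intro h
      exact ⟨_, by linear_combination (c - u) * hz, h⟩
  have hnorm : ‖u - c‖ = ‖(u - c) * (starRingEnd ℂ) (z : ℂ)‖ := by
    rw [norm_mul, RCLike.norm_conj, Circle.norm_coe, mul_one]
  rw [key, hnorm]
  generalize (u - c) * (starRingEnd ℂ) (z : ℂ) = v
  have hq' : (1 : ℝ) ≤ q := by exact_mod_cast hq
  have ha : Real.pi / q ≤ Real.pi := div_le_self Real.pi_pos.le hq'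
  rcases eq_or_ne v 0 with rfl | hv
  · simp; positivity
  · conv_rhs => rw [← Complex.norm_mul_cos_arg v]
    rw [mul_le_mul_iff_right₀ (norm_pos_iff.2 hv), ← Real.cos_abs v.arg]
    exact (Real.strictAntiOn_cos.le_iff_ge ⟨by positivity, ha⟩
      ⟨abs_nonneg _, Complex.abs_arg_le_pi v⟩).symm

theorem isClosed_setOf_mem_regularSector {q : ℕ} (hq : 1 ≤ q) :
    IsClosed {p : (ℂ × Circle) × ℂ | p.2 ∈ regularSector q p.1.1 p.1.2} := by
  simp only [mem_regularSector_iff hq]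
  exact isClosed_le (by fun_prop) (by fun_prop)

theorem isClosed_regularSector {q : ℕ} (hq : 1 ≤ q) (c : ℂ) (z : Circle) :
    IsClosed (regularSector q c z) :=
  (isClosed_setOf_mem_regularSector hq).preimage
    (f := fun u : ℂ => ((c, z), u)) (by fun_prop)

theorem volume_line_eq_zero (c : ℂ) {d : ℂ} (hd : d ≠ 0) :
    volume {u : ℂ | ((u - c) * d).im = 0} = 0 := by
  let L : ℂ →ₗ[ℝ] ℝ := Complex.imLm ∘ₗ LinearMap.mulRight ℝ d
  have hL : LinearMap.ker L ≠ ⊤ := by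
    intro h
    have : d⁻¹ * Complex.I ∈ LinearMap.ker L := h ▸ Submodule.mem_top
    have h2 : d⁻¹ * Complex.I * d = Complex.I := by field_simp
    simp [L, h2] at this
  have h0 := Measure.addHaar_submodule (volume : Measure ℂ) _ hL
  have : {u : ℂ | ((u - c) * d).im = 0} = (fun u => u - c) ⁻¹' (LinearMap.ker L : Set ℂ) := by
    ext u; simp [L]
  simp only [sub_eq_add_neg] at this
  simp only [sub_eq_add_neg]
  rw [this, measure_preimage_add_right, h0]

/-- The boundary of a sector lies on two lines through the apex. -/
theorem volume_sector_boundary (a : ℝ) (c : ℂ) (z : Circle) :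
    volume {u : ℂ | ‖u - c‖ * Real.cos a = ((u - c) * (starRingEnd ℂ) (z : ℂ)).re} = 0 := by
  have hne : ∀ t : ℝ, (starRingEnd ℂ) (z : ℂ) * Complex.exp (t * Complex.I) ≠ 0 := by
    intro t
    exact mul_ne_zero (by simp) (Complex.exp_ne_zero _)
  refine measure_mono_null ?_ (measure_union_null (volume_line_eq_zero c (hne a))
    (volume_line_eq_zero c (hne (-a))))
  intro u hu
  simp only [Set.mem_ofPred_eq] at hu
  have hnorm : ‖u - c‖ = ‖(u - c) * (starRingEnd ℂ) (z : ℂ)‖ := by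
    rw [norm_mul, RCLike.norm_conj, Circle.norm_coe, mul_one]
  rw [hnorm] at hu
  simp only [Set.mem_union, Set.mem_ofPred_eq, ← mul_assoc]
  generalize (u - c) * (starRingEnd ℂ) (z : ℂ) = v at hu
  have h1 : v.re ^ 2 + v.im ^ 2 = ‖v‖ ^ 2 := by
    rw [← Complex.normSq_eq_norm_sq, Complex.normSq_apply]; ring
  have h2 : (v.im - ‖v‖ * Real.sin a) * (v.im + ‖v‖ * Real.sin a) = 0 := by
    have := Real.sin_sq_add_cos_sq a
    rw [← hu] at h1
    linear_combination h1 - ‖v‖ ^ 2 * this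
  rcases mul_eq_zero.1 h2 with h | h
  · right
    simp [Complex.exp_ofReal_mul_I_re, Complex.exp_ofReal_mul_I_im, Complex.mul_im, -Complex.ofReal_neg]
    rw [← hu]; linear_combination Real.cos a * h
  · left
    simp [Complex.exp_ofReal_mul_I_re, Complex.exp_ofReal_mul_I_im, Complex.mul_im]
    rw [← hu]; linear_combination Real.cos a * h

theorem continuous_measureReal_regularSector {q : ℕ} (hq : 1 ≤ q) {μ : Measure ℂ} (hμ : IsMass μ) :
    Continuous fun p : ℂ × Circle => μ.real (regularSector q p.1 p.2) := by
  have := hμ.finite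
  rw [continuous_iff_continuousAt]
  rintro ⟨c, z⟩
  refine (ENNReal.tendsto_toReal (measure_ne_top μ _)).comp ?_
  refine tendsto_measure_of_ae_tendsto_indicator_of_isFiniteMeasure _
    (isClosed_regularSector hq _ _).measurableSet
    (fun p => (isClosed_regularSector hq p.1 p.2).measurableSet) ?_
  have hnull := hμ.absCont (volume_sector_boundary (Real.pi / q) c z)
  filter_upwards [measure_eq_zero_iff_ae_notMem.1 hnull] with u hu
  change _ ≠ _ at hu
  simp only [mem_regularSector_iff hq]
  have hl : ContinuousAt (fun p : ℂ × Circle => ‖u - p.1‖ * Real.cos (Real.pi / q)) (c, z) := by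
    fun_prop
  have hr : ContinuousAt (fun p : ℂ × Circle => ((u - p.1) * (starRingEnd ℂ) (p.2 : ℂ)).re)
      (c, z) := by fun_prop
  rcases lt_or_gt_of_ne hu with h | h
  · filter_upwards [hl.eventually_lt hr h] with p hp
    exact iff_of_true hp.le h.le
  · filter_upwards [hr.eventually_lt hl h] with p hp
    exact iff_of_false hp.not_ge h.not_ge

/-! ### The geometric median -/

/-- The cosine of the angle between `x - c` and `e`, times `‖e‖`. At `x = c` the value is `0`, by
division by zero. -/
noncomputable def dirCos (c e x : ℂ) : ℝ := ((x - c) * (starRingEnd ℂ) e).re / ‖x - c‖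

theorem abs_dirCos_le (c e x : ℂ) : |dirCos c e x| ≤ ‖e‖ := by
  rw [dirCos, abs_div, abs_norm]
  refine div_le_of_le_mul₀ (norm_nonneg _) (norm_nonneg _) ?_
  calc _ ≤ ‖(x - c) * (starRingEnd ℂ) e‖ := Complex.abs_re_le_norm _
    _ = _ := by rw [norm_mul, RCLike.norm_conj, mul_comm]

theorem measurable_dirCos (c e : ℂ) : Measurable (dirCos c e) := by
  unfold dirCos
  fun_prop

theorem integrable_dirCos (μ : Measure ℂ) [IsFiniteMeasure μ] (c e : ℂ) :
    Integrable (dirCos c e) μ :=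
  Integrable.of_bound (measurable_dirCos c e).aestronglyMeasurable ‖e‖
    (ae_of_all _ fun x => abs_dirCos_le c e x)

theorem hasDerivAt_norm_sub_smul {w : ℂ} (hw : w ≠ 0) (e : ℂ) :
    HasDerivAt (fun t : ℝ => ‖w - t * e‖) (-(w * (starRingEnd ℂ) e).re / ‖w‖) 0 := by
  have h1 : HasDerivAt (fun t : ℝ => w - t * e) (-e) 0 := by
    simpa using ((Complex.ofRealCLM.hasDerivAt (x := (0 : ℝ))).mul_const e).const_sub w
  have h2 := h1.norm_sq.sqrt (by simpa using hw)
  simp only [Real.sqrt_sq (norm_nonneg _)] at h2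
  convert! h2 using 1
  simp [Complex.inner]
  field_simp

/-- The renormalized total distance `∫ (‖x - c‖ - ‖x‖) dμ`; the correction `‖x‖` makes it finite
for masses without a first moment. -/
noncomputable def totalDist (μ : Measure ℂ) (c : ℂ) : ℝ := ∫ x, (‖x - c‖ - ‖x‖) ∂μ

theorem abs_norm_sub_sub_norm_le (x c : ℂ) : |‖x - c‖ - ‖x‖| ≤ ‖c‖ := by
  simpa using abs_norm_sub_norm_le (x - c) x

theorem integrable_norm_sub_sub_norm (μ : Measure ℂ) [IsFiniteMeasure μ] (c : ℂ) :
    Integrable (fun x => ‖x - c‖ - ‖x‖) μ :=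
  Integrable.of_bound (by fun_prop) ‖c‖ (ae_of_all _ fun x => abs_norm_sub_sub_norm_le x c)

theorem continuous_totalDist (μ : Measure ℂ) [IsFiniteMeasure μ] : Continuous (totalDist μ) := by
  have : LipschitzWith (μ.real Set.univ).toNNReal (totalDist μ) := by
    refine LipschitzWith.of_dist_le_mul fun c d => ?_
    rw [Real.coe_toNNReal _ measureReal_nonneg, Real.dist_eq, totalDist, totalDist,
      ← integral_sub (integrable_norm_sub_sub_norm μ c) (integrable_norm_sub_sub_norm μ d),
      mul_comm, ← Real.norm_eq_abs]
    refine norm_integral_le_of_norm_le_const (ae_of_all _ fun x => ?_)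
    rw [Real.norm_eq_abs, dist_comm, dist_eq_norm]
    have := abs_norm_sub_norm_le (x - c) (x - d)
    simpa using this
  exact this.continuous

theorem exists_measureReal_compl_closedBall_lt (μ : Measure ℂ) [IsFiniteMeasure μ] {ε : ℝ}
    (hε : 0 < ε) : ∃ R : ℝ, μ.real (Metric.closedBall 0 R)ᶜ < ε := by
  have h := tendsto_measure_iInter_atTop (μ := μ) (s := fun R : ℝ => (Metric.closedBall (0 : ℂ) R)ᶜ)
    (fun R => Metric.isClosed_closedBall.measurableSet.compl.nullMeasurableSet)
    (fun a b hab => Set.compl_subset_compl.2 (Metric.closedBall_subset_closedBall hab))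
    ⟨0, measure_ne_top _ _⟩
  have h0 : ⋂ R : ℝ, (Metric.closedBall (0 : ℂ) R)ᶜ = ∅ := by
    ext x
    simp only [Set.mem_iInter, Set.mem_compl_iff, Metric.mem_closedBall, dist_zero_right,
      Set.mem_empty_iff_false, iff_false, not_forall, not_not]
    exact ⟨‖x‖, le_rfl⟩
  rw [h0, measure_empty] at h
  have h' := (ENNReal.tendsto_toReal ENNReal.zero_ne_top).comp h
  exact (h'.eventually (gt_mem_nhds (by simpa using hε))).exists

theorem tendsto_totalDist {μ : Measure ℂ} [IsFiniteMeasure μ] (hm : 0 < μ.real Set.univ) :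
    Tendsto (totalDist μ) (cocompact ℂ) atTop := by
  obtain ⟨R, hR⟩ := exists_measureReal_compl_closedBall_lt μ (ε := μ.real Set.univ / 4)
    (by positivity)
  set m := μ.real Set.univ
  set B := Metric.closedBall (0 : ℂ) R
  have hB : MeasurableSet B := Metric.isClosed_closedBall.measurableSet
  have hadd : μ.real B + μ.real Bᶜ = m := measureReal_add_measureReal_compl hB
  have key : ∀ c, ‖c‖ * (m / 2) - 2 * |R| * m ≤ totalDist μ c := by
    intro c
    have hi := integrable_norm_sub_sub_norm μ c
    have h1 : (‖c‖ - 2 * |R|) * μ.real B ≤ ∫ x in B, (‖x - c‖ - ‖x‖) ∂μ := by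
      have := setIntegral_mono_on (integrableOn_const (C := ‖c‖ - 2 * |R|)
        (measure_ne_top μ B)) hi.integrableOn hB (fun x hx => ?_)
      · simpa [mul_comm] using this
      · have h2 : ‖x‖ ≤ |R| := (mem_closedBall_zero_iff.1 hx).trans (le_abs_self R)
        have h3 : ‖c‖ ≤ ‖x‖ + ‖x - c‖ := by
          have := norm_sub_le x (x - c); simpa using this
        linarith
    have h2 : -‖c‖ * μ.real Bᶜ ≤ ∫ x in Bᶜ, (‖x - c‖ - ‖x‖) ∂μ := by
      have := setIntegral_mono_on (integrableOn_const (C := -‖c‖)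
        (measure_ne_top μ Bᶜ)) hi.integrableOn hB.compl (fun x hx => ?_)
      · simpa [mul_comm] using this
      · exact (abs_le.1 (abs_norm_sub_sub_norm_le x c)).1
    have h3 : totalDist μ c = _ := (integral_add_compl hB hi).symm
    have h4 : 0 ≤ ‖c‖ := norm_nonneg c
    have h5 : 0 ≤ |R| := abs_nonneg R
    have h6 : 0 ≤ μ.real Bᶜ := measureReal_nonneg
    rw [h3]
    have h7 : μ.real B = m - μ.real Bᶜ := by linarith
    rw [h7] at h1
    nlinarith
  refine tendsto_atTop_mono key ?_
  exact tendsto_atTop_add_const_right _ _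
    ((tendsto_norm_cocompact_atTop (E := ℂ)).atTop_mul_const (by positivity))

/-- First order condition at a geometric median: seen from it, the unit vectors towards the
points of the mass average to zero. There are no atoms, so the failure of differentiability of
`‖x - c‖` at `x = c` is harmless. -/
theorem exists_integral_dirCos_eq_zero {μ : Measure ℂ} (hμ : IsMass μ) :
    ∃ c : ℂ, ∀ e : ℂ, ∫ x, dirCos c e x ∂μ = 0 := by
  have := hμ.finite
  rcases measure_eq_zero_or_measureReal_univ_pos μ with rfl | hm
  · exact ⟨0, by simp⟩
  obtain ⟨c, hc⟩ := (continuous_totalDist μ).exists_forall_le (tendsto_totalDist hm)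
  refine ⟨c, fun e => ?_⟩
  have hd := hasDerivAt_integral_of_dominated_loc_of_lip (μ := μ) (x₀ := (0 : ℝ)) (s := Set.univ)
    (F := fun (t : ℝ) x => ‖x - (c + t * e)‖ - ‖x‖) (F' := fun x => -dirCos c e x)
    (bound := fun _ => ‖e‖) univ_mem
    (Eventually.of_forall fun t => (integrable_norm_sub_sub_norm μ _).aestronglyMeasurable)
    (integrable_norm_sub_sub_norm μ _)
    (measurable_dirCos c e).neg.aestronglyMeasurable
    (ae_of_all _ fun x => ?_) (integrable_const _) ?_
  · have h1 : IsLocalMin (fun t : ℝ => totalDist μ (c + t * e)) 0 :=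
      Eventually.of_forall fun t => by simpa using hc (c + t * e)
    have h2 := h1.hasDerivAt_eq_zero hd.2
    rwa [integral_neg, neg_eq_zero] at h2
  · refine LipschitzOnWith.of_dist_le_mul fun s _ t _ => ?_
    have := abs_norm_sub_norm_le (x - (c + s * e)) (x - (c + t * e))
    have h3 : x - (c + s * e) - (x - (c + t * e)) = ((t - s : ℝ) : ℂ) * e := by push_cast; ring
    rw [h3, norm_mul, Complex.norm_real] at this
    simp only [Real.dist_eq, Real.coe_nnabs, abs_norm]
    rw [abs_sub_comm s t, mul_comm ‖e‖]
    simpa using this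
  · filter_upwards [hμ.ae_ne c] with x hx
    have := (hasDerivAt_norm_sub_smul (sub_ne_zero.2 hx) e).sub_const ‖x‖
    simpa only [dirCos, neg_div, sub_sub] using this

/-! ### Centres for the supremum norm -/

theorem abs_sectorDeviation_le {q : ℕ} (hq : 1 ≤ q) (μ : Measure ℂ) [IsFiniteMeasure μ] (c : ℂ)
    (z : Circle) : |sectorDeviation q μ c z| ≤ μ.real Set.univ := by
  have h1 : μ.real (regularSector q c z) ≤ μ.real Set.univ := measureReal_mono (Set.subset_univ _)
  have h2 : 0 ≤ μ.real (regularSector q c z) := measureReal_nonneg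
  have h3 : μ.real Set.univ / q ≤ μ.real Set.univ :=
    div_le_self measureReal_nonneg (by exact_mod_cast hq)
  have h4 : 0 ≤ μ.real Set.univ / q := by positivity
  rw [sectorDeviation, abs_le]
  constructor <;> linarith

theorem abs_sectorDeviation_le_deviationSupNorm {q : ℕ} (hq : 1 ≤ q) (μ : Measure ℂ)
    [IsFiniteMeasure μ] (c : ℂ) (z : Circle) :
    |sectorDeviation q μ c z| ≤ deviationSupNorm q μ c :=
  le_ciSup (f := fun z => |sectorDeviation q μ c z|)
    ⟨μ.real Set.univ, by rintro _ ⟨z, rfl⟩; exact abs_sectorDeviation_le hq μ c z⟩ z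

/-- At a geometric median a sector with angle at most `120°` carries at most two thirds of
the mass: its points have cosine at least `1/2` with the central direction, the others at least
`-1`, and the cosines average to zero. -/
theorem exists_measureReal_regularSector_le_two_thirds {q : ℕ} (hq : 3 ≤ q) {μ : Measure ℂ}
    (hμ : IsMass μ) :
    ∃ c, ∀ z, μ.real (regularSector q c z) ≤ 2 / 3 * μ.real Set.univ := by
  have := hμ.finite
  obtain ⟨c, hc⟩ := exists_integral_dirCos_eq_zero hμ
  refine ⟨c, fun z => ?_⟩
  have hS := (isClosed_regularSector (by lia : 1 ≤ q) c z).measurableSet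
  have hcos := half_le_cos_pi_div hq
  have hint : Integrable ((regularSector q c z).indicator (1 : ℂ → ℝ)) μ :=
    (integrable_const (1 : ℝ)).indicator hS
  have hle : ∫ x, (3 / 2 * (regularSector q c z).indicator (1 : ℂ → ℝ) x - 1) ∂μ
      ≤ ∫ x, dirCos c z x ∂μ := by
    refine integral_mono_ae ((hint.const_mul _).sub (integrable_const _))
      (integrable_dirCos μ c z) ?_
    filter_upwards [hμ.ae_ne c] with x hx
    have hpos : 0 < ‖x - c‖ := norm_pos_iff.2 (sub_ne_zero.2 hx)
    by_cases hxS : x ∈ regularSector q c z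
    · have h1 := (mem_regularSector_iff (by lia : 1 ≤ q)).1 hxS
      simp only [Set.indicator_of_mem hxS, Pi.one_apply, dirCos]
      rw [le_div_iff₀ hpos]
      nlinarith
    · simp only [Set.indicator_of_notMem hxS]
      have := (abs_le.1 (abs_dirCos_le c z x)).1
      rw [Circle.norm_coe] at this
      linarith
  rw [hc, integral_sub (hint.const_mul _) (integrable_const _), integral_const_mul,
    integral_indicator_one hS] at hle
  simp at hle
  linarith

theorem exists_median {μ : Measure ℂ} [IsFiniteMeasure μ] {f : ℂ → ℝ} (hf : Measurable f)
    (h0 : ∀ t, μ {x | f x = t} = 0) :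
    ∃ t, μ.real {x | f x ≤ t} ≤ μ.real Set.univ / 2 ∧
      μ.real {x | t ≤ f x} ≤ μ.real Set.univ / 2 := by
  have hmeas : ∀ t, MeasurableSet {x | f x ≤ t} := fun t => measurableSet_le hf measurable_const
  have hlim : ∀ (l : Filter ℝ) [l.IsCountablyGenerated] (A : Set ℂ), MeasurableSet A →
      (∀ᵐ x ∂μ, ∀ᶠ t in l, x ∈ {x | f x ≤ t} ↔ x ∈ A) →
      Tendsto (fun t => μ.real {x | f x ≤ t}) l (𝓝 (μ.real A)) := by
    intro l _ A hA h
    exact (ENNReal.tendsto_toReal (measure_ne_top μ _)).comp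
      (tendsto_measure_of_ae_tendsto_indicator_of_isFiniteMeasure l hA hmeas h)
  have hcont : Continuous fun t => μ.real {x | f x ≤ t} := by
    rw [continuous_iff_continuousAt]
    refine fun t => hlim _ _ (hmeas t) ?_
    filter_upwards [measure_eq_zero_iff_ae_notMem.1 (h0 t)] with x hx
    rcases lt_or_gt_of_ne (show f x ≠ t from hx) with h | h
    · filter_upwards [lt_mem_nhds h] with s hs
      exact iff_of_true (le_of_lt hs) h.le
    · filter_upwards [gt_mem_nhds h] with s hs
      exact iff_of_false (not_le_of_gt hs) (not_le_of_gt h)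
  have htop := hlim atTop Set.univ MeasurableSet.univ (ae_of_all _ fun x => by
    filter_upwards [eventually_ge_atTop (f x)] with t ht
    exact iff_of_true ht trivial)
  have hbot := hlim atBot ∅ MeasurableSet.empty (ae_of_all _ fun x => by
    filter_upwards [eventually_lt_atBot (f x)] with t ht
    exact iff_of_false (not_le_of_gt ht) (Set.notMem_empty x))
  rw [measureReal_empty] at hbot
  obtain ⟨t, ht⟩ : ∃ t, μ.real {x | f x ≤ t} = μ.real Set.univ / 2 := by
    rcases (measureReal_nonneg (μ := μ) (s := Set.univ)).eq_or_lt with h | h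
    · refine ⟨0, le_antisymm ?_ (by rw [← h]; simp)⟩
      rw [← h, zero_div, h]
      exact measureReal_mono (Set.subset_univ _)
    · exact mem_range_of_exists_le_of_exists_ge hcont
        ((hbot.eventually (gt_mem_nhds (half_pos h))).exists.imp fun _ => le_of_lt)
        ((htop.eventually (lt_mem_nhds (half_lt_self h))).exists.imp fun _ => le_of_lt)
  refine ⟨t, ht.le, ?_⟩
  have h1 : μ.real {x | t ≤ f x} ≤ μ.real ({x | f x ≤ t}ᶜ ∪ {x | f x = t}) := by
    refine measureReal_mono fun x hx => ?_
    rcases (show t ≤ f x from hx).lt_or_eq with h | h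
    · exact Or.inl (not_le_of_gt h)
    · exact Or.inr h.symm
  have h2 := measureReal_union_le (μ := μ) {x | f x ≤ t}ᶜ {x | f x = t}
  have h3 := measureReal_add_measureReal_compl (μ := μ) (hmeas t)
  have h4 : μ.real {x | f x = t} = 0 := by simp [measureReal_def, h0]
  linarith

/-- A vector `(x, y)` of norm `N` that makes an angle of at most `45°` with a unit vector
`(p, r)`, itself at most `45°` away from the positive first axis, lies in the right half-plane. -/
theorem nonneg_of_norm_mul_le_inner {x y p r N k : ℝ} (hN : N ^ 2 = x ^ 2 + y ^ 2) (hN0 : 0 ≤ N)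
    (hk : 0 ≤ k) (hk2 : 1 / 2 ≤ k ^ 2) (hr : r ^ 2 ≤ 1 / 2) (hp : 0 ≤ p)
    (h : N * k ≤ x * p + y * r) : 0 ≤ x := by
  by_contra! hx
  have h1 : N * k ≤ y * r := by nlinarith
  have h2 : (N * k) ^ 2 ≤ (y * r) ^ 2 := by
    have : 0 ≤ N * k := by positivity
    gcongr
  have h3 : N ^ 2 * (1 / 2) ≤ N ^ 2 * k ^ 2 := by gcongr
  have h4 : y ^ 2 * r ^ 2 ≤ y ^ 2 * (1 / 2) := by gcongr
  nlinarith [sq_pos_of_neg hx]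

/-- At the point whose coordinates are medians, every sector with angle at most `90°` carries
at most half of the mass: it fits into one of the four closed half-planes bounded by the two
median lines. -/
theorem exists_measureReal_regularSector_le_half {q : ℕ} (hq : 4 ≤ q) {μ : Measure ℂ}
    (hμ : IsMass μ) :
    ∃ c, ∀ z, μ.real (regularSector q c z) ≤ μ.real Set.univ / 2 := by
  have := hμ.finite
  obtain ⟨s, hs1, hs2⟩ := exists_median (μ := μ) Complex.measurable_re fun t => hμ.absCont (by
    convert! volume_line_eq_zero t Complex.I_ne_zero using 3
    simp [sub_eq_zero])
  obtain ⟨t, ht1, ht2⟩ := exists_median (μ := μ) Complex.measurable_im fun t => hμ.absCont (by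
    convert! volume_line_eq_zero (t * Complex.I) one_ne_zero using 3
    simp [sub_eq_zero])
  refine ⟨⟨s, t⟩, fun z => ?_⟩
  have hcos : Real.sqrt 2 / 2 ≤ Real.cos (Real.pi / q) := by
    rw [← Real.cos_pi_div_four]
    have hq' : (4 : ℝ) ≤ q := by exact_mod_cast hq
    refine Real.cos_le_cos_of_nonneg_of_le_pi (by positivity) (by linarith [Real.pi_pos]) ?_
    gcongr
  set k := Real.cos (Real.pi / q)
  have hk0 : 0 ≤ k := le_trans (by positivity) hcos
  have hk2 : 1 / 2 ≤ k ^ 2 := by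
    have h2 : Real.sqrt 2 ^ 2 = 2 := Real.sq_sqrt (by norm_num)
    nlinarith [Real.sqrt_nonneg 2]
  have hz : (z : ℂ).re ^ 2 + (z : ℂ).im ^ 2 = 1 := by
    have := Circle.normSq_coe z
    rw [Complex.normSq_apply] at this
    linarith
  set p := (z : ℂ).re
  set r := (z : ℂ).im
  have hmem : ∀ u ∈ regularSector q ⟨s, t⟩ z, ∃ N : ℝ, 0 ≤ N ∧
      N ^ 2 = (u.re - s) ^ 2 + (u.im - t) ^ 2 ∧ N * k ≤ (u.re - s) * p + (u.im - t) * r := by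
    intro u hu
    refine ⟨‖u - ⟨s, t⟩‖, norm_nonneg _, ?_, ?_⟩
    · rw [← Complex.normSq_eq_norm_sq, Complex.normSq_apply]
      simp; ring
    · have := (mem_regularSector_iff (by lia : 1 ≤ q)).1 hu
      simpa [Complex.mul_re] using this
  rcases le_total (r ^ 2) (1 / 2) with hr | hr
  · rcases le_total 0 p with hp | hp
    · refine le_trans (measureReal_mono fun u hu => ?_) hs2
      obtain ⟨N, hN0, hN, h⟩ := hmem u hu
      have := nonneg_of_norm_mul_le_inner hN hN0 hk0 hk2 hr hp h
      simpa using this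
    · refine le_trans (measureReal_mono fun u hu => ?_) hs1
      obtain ⟨N, hN0, hN, h⟩ := hmem u hu
      have := nonneg_of_norm_mul_le_inner (x := -(u.re - s)) (p := -p) (y := u.im - t) (r := r)
        (by linarith) hN0 hk0 hk2 hr (by linarith) (h.trans_eq (by ring))
      simpa using this
  · have hp : p ^ 2 ≤ 1 / 2 := by linarith
    rcases le_total 0 r with hr | hr
    · refine le_trans (measureReal_mono fun u hu => ?_) ht2
      obtain ⟨N, hN0, hN, h⟩ := hmem u hu
      have := nonneg_of_norm_mul_le_inner (x := u.im - t) (p := r) (by linarith) hN0 hk0 hk2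
        hp hr (h.trans_eq (add_comm _ _))
      simpa using this
    · refine le_trans (measureReal_mono fun u hu => ?_) ht1
      obtain ⟨N, hN0, hN, h⟩ := hmem u hu
      have := nonneg_of_norm_mul_le_inner (x := -(u.im - t)) (p := -r) (y := u.re - s) (r := p)
        (by linarith) hN0 hk0 hk2 hp (by linarith) (h.trans_eq (by ring))
      simpa using this

theorem max_mem_admissibleSup {q : ℕ} (hq : 3 ≤ q) :
    max (1 / (q : ℝ)) (((q : ℝ) - 2) / (2 * (q : ℝ))) ∈ admissibleSup q := by
  intro μ hμ
  have := hμ.finite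
  have hq0 : (0 : ℝ) < q := by exact_mod_cast (by lia : 0 < q)
  set M := max (1 / (q : ℝ)) (((q : ℝ) - 2) / (2 * (q : ℝ)))
  set m := μ.real Set.univ
  have hm : 0 ≤ m := measureReal_nonneg
  -- The lower bound `0 ≤ μ (S)` accounts for `1 / q`.
  suffices h : ∃ c, ∀ z, μ.real (regularSector q c z) ≤ (M + 1 / q) * m by
    obtain ⟨c, hc⟩ := h
    refine ⟨c, ciSup_le fun z => ?_⟩
    have h1 : 0 ≤ μ.real (regularSector q c z) := measureReal_nonneg
    have h2 : 1 / q * m ≤ M * m := by gcongr; exact le_max_left _ _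
    have h3 : m / q = 1 / q * m := by ring
    have h4 := hc z
    rw [sectorDeviation, abs_le]
    constructor <;> linarith
  rcases hq.eq_or_lt with rfl | hq
  · obtain ⟨c, hc⟩ := exists_measureReal_regularSector_le_two_thirds le_rfl hμ
    refine ⟨c, fun z => (hc z).trans ?_⟩
    have : (1 / (3 : ℕ) : ℝ) ≤ M := le_max_left _ _
    push_cast at this ⊢
    gcongr
    linarith
  · obtain ⟨c, hc⟩ := exists_measureReal_regularSector_le_half hq hμ
    refine ⟨c, fun z => (hc z).trans ?_⟩
    have h1 : ((q : ℝ) - 2) / (2 * q) ≤ M := le_max_right _ _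
    have h2 : ((q : ℝ) - 2) / (2 * q) = 1 / 2 - 1 / q := by field_simp
    rw [h2] at h1
    rw [div_eq_mul_one_div, mul_comm]
    gcongr
    linarith

/-! ### Masses without good centres -/

theorem isMass_volume_restrict {s : Set ℂ} (hs : volume s ≠ ⊤) : IsMass (volume.restrict s) :=
  ⟨isFiniteMeasure_restrict.2 hs, Measure.restrict_le_self.absolutelyContinuous⟩

/-- From a point far from a small disc, the disc fits into a sector. -/
theorem exists_ball_subset_regularSector {q : ℕ} (hq : 2 ≤ q) {c p : ℂ} {δ : ℝ} (hδ : 0 < δ)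
    (h : 2 * δ ≤ ‖p - c‖ * (1 - Real.cos (Real.pi / q))) :
    ∃ z, Metric.ball p δ ⊆ regularSector q c z := by
  have hk : 0 ≤ Real.cos (Real.pi / q) := by
    have hq' : (2 : ℝ) ≤ q := by exact_mod_cast hq
    have h0 : 0 ≤ Real.pi / q := by positivity
    have h1 : Real.pi / q ≤ Real.pi / 2 := by gcongr
    exact Real.cos_nonneg_of_mem_Icc ⟨by linarith [Real.pi_pos], h1⟩
  set k := Real.cos (Real.pi / q)
  have hk1 : k ≤ 1 := Real.cos_le_one _
  have hd : 0 < ‖p - c‖ := by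
    by_contra! hd
    have : ‖p - c‖ = 0 := le_antisymm hd (norm_nonneg _)
    rw [this] at h
    linarith
  have hd' : ((‖p - c‖ : ℝ) : ℂ) ≠ 0 := by exact_mod_cast hd.ne'
  let z : Circle := ⟨(p - c) / ‖p - c‖, by
    change _ ∈ Metric.sphere _ _
    rw [mem_sphere_zero_iff_norm, norm_div, Complex.norm_real, norm_norm, div_self hd.ne']⟩
  refine ⟨z, fun u hu => (mem_regularSector_iff (by lia)).2 ?_⟩
  rw [Metric.mem_ball, dist_eq_norm] at hu
  have hz : (p - c) * (starRingEnd ℂ) (z : ℂ) = ‖p - c‖ := by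
    change (p - c) * (starRingEnd ℂ) ((p - c) / ‖p - c‖) = ‖p - c‖
    rw [map_div₀, Complex.conj_ofReal, mul_div_assoc', Complex.mul_conj, Complex.normSq_eq_norm_sq,
      div_eq_iff hd']
    push_cast; ring
  have h1 : (u - c) * (starRingEnd ℂ) (z : ℂ)
      = (u - p) * (starRingEnd ℂ) (z : ℂ) + (‖p - c‖ : ℝ) := by
    linear_combination hz
  have h2 : -δ ≤ ((u - p) * (starRingEnd ℂ) (z : ℂ)).re := by
    have h3 := (abs_le.1 (Complex.abs_re_le_norm ((u - p) * (starRingEnd ℂ) (z : ℂ)))).1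
    rw [norm_mul, RCLike.norm_conj, Circle.norm_coe, mul_one] at h3
    linarith
  have h4 : ‖u - c‖ ≤ δ + ‖p - c‖ := by
    have := norm_add_le (u - p) (p - c)
    rw [sub_add_sub_cancel] at this
    linarith
  rw [h1, Complex.add_re, Complex.ofReal_re]
  have h5 : ‖u - c‖ * k ≤ (δ + ‖p - c‖) * k := by gcongr
  nlinarith

/-- Two small discs of equal mass: every centre is far from one of them, which is then seen
inside a single sector. -/
theorem le_of_mem_admissibleSup {q : ℕ} (hq : 3 ≤ q) {ε : ℝ} (hε : ε ∈ admissibleSup q) :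
    ((q : ℝ) - 2) / (2 * (q : ℝ)) ≤ ε := by
  have hq3 : (3 : ℝ) ≤ q := by exact_mod_cast hq
  have ha0 : 0 < Real.pi / q := by have := Real.pi_pos; positivity
  have ha1 : Real.pi / q ≤ Real.pi / 3 := by have := Real.pi_pos; gcongr
  have hk0 := half_le_cos_pi_div hq
  have hk1 : Real.cos (Real.pi / q) < 1 := by
    rw [← Real.cos_zero]
    exact Real.cos_lt_cos_of_nonneg_of_le_pi le_rfl (by linarith [Real.pi_pos]) ha0
  obtain ⟨δ, hδ⟩ : ∃ δ, 2 * δ = 1 - Real.cos (Real.pi / q) := ⟨_, mul_div_cancel₀ _ two_ne_zero⟩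
  have hδ0 : 0 < δ := by linarith
  have hdisj : Disjoint (Metric.ball (1 : ℂ) δ) (Metric.ball (-1 : ℂ) δ) := by
    refine Metric.ball_disjoint_ball ?_
    rw [dist_eq_norm]
    norm_num
    linarith
  set B := Metric.ball (1 : ℂ) δ ∪ Metric.ball (-1 : ℂ) δ
  set v := volume.real (Metric.ball (0 : ℂ) δ)
  have hv : 0 < v := ENNReal.toReal_pos (Metric.measure_ball_pos _ _ hδ0).ne'
    measure_ball_lt_top.ne
  have hball : ∀ p : ℂ, volume.real (Metric.ball p δ) = v := fun p => by
    simp only [v, measureReal_def, Measure.addHaar_ball_center volume p]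
  have hB : volume B ≠ ⊤ :=
    (measure_union_lt_top measure_ball_lt_top measure_ball_lt_top).ne
  have hBv : volume.real B = 2 * v := by
    rw [measureReal_union hdisj measurableSet_ball measure_ball_lt_top.ne measure_ball_lt_top.ne,
      hball, hball]
    ring
  have hmass := isMass_volume_restrict hB
  have := hmass.finite
  obtain ⟨c, hc⟩ := hε _ hmass
  have huniv : (volume.restrict B).real Set.univ = 2 * v := by
    rw [measureReal_restrict_apply MeasurableSet.univ, Set.univ_inter, hBv]
  obtain ⟨p, hp, hpc⟩ : ∃ p : ℂ, Metric.ball p δ ⊆ B ∧ 1 ≤ ‖p - c‖ := by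
    have h2 : (2 : ℝ) ≤ ‖1 - c‖ + ‖-1 - c‖ := by
      have := norm_sub_le (1 - c) (-1 - c)
      have h3 : (1 - c) - (-1 - c) = 2 := by ring
      rw [h3] at this
      simpa using this
    rcases le_total 1 ‖1 - c‖ with h | h
    · exact ⟨1, Set.subset_union_left, h⟩
    · exact ⟨-1, Set.subset_union_right, by linarith⟩
  obtain ⟨z, hz⟩ := exists_ball_subset_regularSector (by lia : 2 ≤ q) (c := c) (p := p) hδ0 (by
    rw [hδ]
    exact le_mul_of_one_le_left (by linarith) hpc)
  have h1 : v ≤ (volume.restrict B).real (regularSector q c z) := by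
    refine le_trans ?_ (measureReal_mono hz)
    rw [measureReal_restrict_apply measurableSet_ball, Set.inter_eq_left.2 hp, hball]
  have h2 := (abs_sectorDeviation_le_deviationSupNorm (by lia : 1 ≤ q) _ c z).trans hc
  rw [sectorDeviation, huniv] at h2
  have h3 := (le_abs_self _).trans h2
  have h4 : ((q : ℝ) - 2) / (2 * q) = 1 / 2 - 1 / q := by field_simp
  rw [h4]
  have h5 : (1 / 2 - 1 / (q : ℝ)) * (2 * v) ≤ ε * (2 * v) := by
    have : (1 / 2 - 1 / (q : ℝ)) * (2 * v) = v - 2 * v / q := by field_simp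
    rw [this]
    linarith
  exact le_of_mul_le_mul_right h5 (by positivity)

theorem volume_real_re_prod_im (a b a' b' : ℝ) (h : a ≤ b) (h' : a' ≤ b') :
    volume.real (Set.Icc a b ×ℂ Set.Icc a' b') = (b - a) * (b' - a') := by
  have h1 := Complex.volume_preserving_equiv_real_prod.measure_preimage
    (measurableSet_Icc.prod measurableSet_Icc :
      MeasurableSet (Set.Icc a b ×ˢ Set.Icc a' b')).nullMeasurableSet
  have h2 : Complex.measurableEquivRealProd ⁻¹' (Set.Icc a b ×ˢ Set.Icc a' b')
      = Set.Icc a b ×ℂ Set.Icc a' b' := rfl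
  rw [h2] at h1
  rw [measureReal_def, h1, Measure.volume_eq_prod, Measure.prod_prod, ENNReal.toReal_mul,
    Real.volume_Icc, Real.volume_Icc, ENNReal.toReal_ofReal (by linarith),
    ENNReal.toReal_ofReal (by linarith)]

theorem volume_re_prod_im_ne_top (a b a' b' : ℝ) :
    volume (Set.Icc a b ×ℂ Set.Icc a' b') ≠ ⊤ :=
  (isCompact_Icc.reProdIm isCompact_Icc).measure_lt_top.ne

/-- In a sector with angle at most `120°`, the distance to the apex is at most twice its component
in the central direction. -/
theorem abs_re_sub_le_of_mem_regularSector {q : ℕ} (hq : 3 ≤ q) {c u : ℂ} {z : Circle} {δ : ℝ}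
    (hu : u ∈ regularSector q c z)
    (h : ((u - c) * (starRingEnd ℂ) (z : ℂ)).re ≤ δ) : |u.re - c.re| ≤ 2 * δ := by
  have h1 := (mem_regularSector_iff (by lia : 1 ≤ q)).1 hu
  have hcos := half_le_cos_pi_div hq
  have h2 := Complex.abs_re_le_norm (u - c)
  rw [Complex.sub_re] at h2
  nlinarith [norm_nonneg (u - c)]

/-- A thin horizontal rectangle: for every centre, the upward or the downward sector is almost
empty. -/
theorem one_div_le_of_mem_admissibleSup {q : ℕ} (hq : 3 ≤ q) {ε : ℝ} (hε : ε ∈ admissibleSup q) :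
    1 / (q : ℝ) ≤ ε := by
  refine le_of_forall_pos_le_add fun η hη => ?_
  obtain ⟨δ, hδ, rfl⟩ : ∃ δ, 0 < δ ∧ 4 * δ = η := ⟨η / 4, by positivity, by ring⟩
  set B := Set.Icc (0 : ℝ) 1 ×ℂ Set.Icc 0 δ
  have hBv : volume.real B = δ := by
    rw [volume_real_re_prod_im _ _ _ _ zero_le_one hδ.le]; ring
  have hmass := isMass_volume_restrict (volume_re_prod_im_ne_top 0 1 0 δ)
  have := hmass.finite
  obtain ⟨c, hc⟩ := hε _ hmass
  change deviationSupNorm q (volume.restrict B) c ≤ _ at hc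
  have huniv : (volume.restrict B).real Set.univ = δ := by
    rw [measureReal_restrict_apply MeasurableSet.univ, Set.univ_inter, hBv]
  obtain ⟨z, hz⟩ : ∃ z : Circle, ∀ u ∈ B, ((u - c) * (starRingEnd ℂ) (z : ℂ)).re ≤ δ := by
    rcases le_total 0 c.im with h | h
    · refine ⟨⟨Complex.I, by simp [Submonoid.unitSphere]⟩, fun u hu => ?_⟩
      have := hu.2.2
      simp [Complex.mul_re]
      linarith
    · refine ⟨⟨-Complex.I, by simp [Submonoid.unitSphere]⟩, fun u hu => ?_⟩
      have := hu.2.1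
      simp [Complex.mul_re]
      linarith
  have h1 : (volume.restrict B).real (regularSector q c z) ≤ 4 * δ * δ := by
    rw [measureReal_restrict_apply (isClosed_regularSector (by lia) c z).measurableSet]
    refine (measureReal_mono (s₂ := Set.Icc (c.re - 2 * δ) (c.re + 2 * δ) ×ℂ Set.Icc 0 δ)
      ?_ (volume_re_prod_im_ne_top _ _ _ _)).trans_eq ?_
    · rintro u ⟨hu, huB⟩
      have := abs_le.1 (abs_re_sub_le_of_mem_regularSector hq hu (hz u huB))
      exact ⟨⟨by linarith, by linarith⟩, huB.2⟩
    · rw [volume_real_re_prod_im _ _ _ _ (by linarith) hδ.le]; ring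
  have h2 := (abs_sectorDeviation_le_deviationSupNorm (by lia : 1 ≤ q) _ c z).trans hc
  rw [sectorDeviation, huniv] at h2
  have h3 := (neg_abs_le _).trans' (neg_le_neg h2)
  have h5 : 1 / (q : ℝ) * δ ≤ (ε + 4 * δ) * δ := by
    have : 1 / (q : ℝ) * δ = δ / q := by ring
    rw [this]
    linarith
  exact le_of_mul_le_mul_right h5 hδ

theorem isLeast_admissibleSup {q : ℕ} (hq : 3 ≤ q) :
    IsLeast (admissibleSup q) (max (1 / (q : ℝ)) (((q : ℝ) - 2) / (2 * (q : ℝ)))) :=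
  ⟨max_mem_admissibleSup hq, fun _ hε =>
    max_le (one_div_le_of_mem_admissibleSup hq hε) (le_of_mem_admissibleSup hq hε)⟩

/-! ### The `L²`-norm -/

/-- The indicator function of the arc `|θ| ≤ π / q` on the circle, minus its mean `1 / q` and the
multiple `2 b` of the first harmonic. For `b = sin (π / q) / π` this removes all Fourier
coefficients of index `-1`, `0` and `1`. -/
noncomputable def arcResidual (q : ℕ) (b θ : ℝ) : ℝ :=
  (if Real.cos (Real.pi / q) ≤ Real.cos θ then 1 else 0) - 1 / (q : ℝ) - 2 * b * Real.cos θ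

theorem measurable_arcResidual (q : ℕ) (b : ℝ) : Measurable (arcResidual q b) := by
  unfold arcResidual
  refine Measurable.sub (Measurable.sub ?_ measurable_const) (by fun_prop)
  exact Measurable.ite (measurableSet_le measurable_const Real.measurable_cos) measurable_const
    measurable_const

theorem periodic_arcResidual (q : ℕ) (b : ℝ) :
    Function.Periodic (arcResidual q b) (2 * Real.pi) := fun θ => by
  simp only [arcResidual, Real.cos_add_two_pi]

theorem abs_arcResidual_le (q : ℕ) (b θ : ℝ) : |arcResidual q b θ| ≤ 2 + 2 * |b| := by
  have h1 : |(if Real.cos (Real.pi / q) ≤ Real.cos θ then 1 else 0 : ℝ)| ≤ 1 := by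
    split_ifs <;> simp
  have h2 : |1 / (q : ℝ)| ≤ 1 := by
    rw [abs_of_nonneg (by positivity)]
    rw [one_div]
    exact Nat.cast_inv_le_one q
  have h3 : |2 * b * Real.cos θ| ≤ 2 * |b| := by
    rw [abs_mul, abs_mul, abs_two]
    exact mul_le_of_le_one_right (by positivity) (Real.abs_cos_le_one θ)
  have h4 := abs_sub ((if Real.cos (Real.pi / q) ≤ Real.cos θ then 1 else 0 : ℝ) - 1 / (q : ℝ))
    (2 * b * Real.cos θ)
  have h5 := abs_sub (if Real.cos (Real.pi / q) ≤ Real.cos θ then 1 else 0 : ℝ) (1 / (q : ℝ))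
  rw [arcResidual]
  linarith

theorem cos_le_cos_iff_mem_Icc {a θ : ℝ} (ha : 0 ≤ a) (ha' : a ≤ Real.pi)
    (hθ : θ ∈ Set.Icc (-Real.pi) Real.pi) :
    Real.cos a ≤ Real.cos θ ↔ θ ∈ Set.Icc (-a) a := by
  rw [← Real.cos_abs θ, Set.mem_Icc, ← abs_le]
  exact Real.strictAntiOn_cos.le_iff_ge ⟨ha, ha'⟩ ⟨abs_nonneg _, abs_le.2 hθ⟩

theorem integral_arcResidual_sq {q : ℕ} (hq : 2 ≤ q) (b : ℝ) :
    ∫ θ in (-Real.pi)..Real.pi, arcResidual q b θ ^ 2 =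
      2 * Real.pi * (1 / (q : ℝ) - 1 / (q : ℝ) ^ 2 - 4 * b * Real.sin (Real.pi / q) / Real.pi
        + 2 * b ^ 2) := by
  have hq' : (2 : ℝ) ≤ q := by exact_mod_cast hq
  have hpi := Real.pi_pos
  set a := Real.pi / q with ha
  have ha0 : 0 ≤ a := by positivity
  have ha1 : a < Real.pi := div_lt_self hpi (by linarith)
  set f : ℝ → ℝ := fun θ => 1 - 2 / q - 4 * b * Real.cos θ with hf
  set g : ℝ → ℝ := fun θ => 1 / (q : ℝ) ^ 2 + 4 * b / q * Real.cos θ + 4 * b ^ 2 * Real.cos θ ^ 2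
    with hg
  have hfc : Continuous f := by fun_prop
  have hgc : Continuous g := by fun_prop
  have h1 : ∀ θ, arcResidual q b θ ^ 2
      = {θ | Real.cos a ≤ Real.cos θ}.indicator f θ + g θ := by
    intro θ
    by_cases h : Real.cos a ≤ Real.cos θ
    · rw [Set.indicator_of_mem (by exact h), arcResidual, if_pos h]
      simp only [hf, hg]; ring
    · rw [Set.indicator_of_notMem (by exact h), arcResidual, if_neg h]
      simp only [hg]; ring
  have hms : MeasurableSet {θ | Real.cos a ≤ Real.cos θ} :=
    measurableSet_le measurable_const Real.measurable_cos
  have hfi : IntervalIntegrable ({θ | Real.cos a ≤ Real.cos θ}.indicator f) volume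
      (-Real.pi) Real.pi := by
    rw [intervalIntegrable_iff]
    exact (intervalIntegrable_iff.1 (hfc.intervalIntegrable _ _)).indicator hms
  have h2 : ∫ θ in (-Real.pi)..Real.pi, {θ | Real.cos a ≤ Real.cos θ}.indicator f θ
      = ∫ θ in (-a)..a, f θ := by
    rw [intervalIntegral.integral_of_le (by linarith), intervalIntegral.integral_of_le (by linarith),
      ← integral_Icc_eq_integral_Ioc, ← integral_Icc_eq_integral_Ioc, setIntegral_indicator hms]
    congr 2
    ext θ
    constructor
    · rintro ⟨h, h'⟩
      exact (cos_le_cos_iff_mem_Icc ha0 ha1.le h).1 h'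
    · intro h
      have h' : θ ∈ Set.Icc (-Real.pi) Real.pi := ⟨by linarith [h.1], by linarith [h.2]⟩
      exact ⟨h', (cos_le_cos_iff_mem_Icc ha0 ha1.le h').2 h⟩
  have h3 : ∫ θ in (-a)..a, f θ = (1 - 2 / q) * (2 * a) - 8 * b * Real.sin a := by
    simp only [hf]
    rw [intervalIntegral.integral_sub (by simp)
      ((by fun_prop : Continuous fun θ => 4 * b * Real.cos θ).intervalIntegrable _ _),
      intervalIntegral.integral_const_mul, integral_cos, intervalIntegral.integral_const,
      Real.sin_neg, smul_eq_mul]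
    ring
  have h4 : ∫ θ in (-Real.pi)..Real.pi, g θ
      = 1 / (q : ℝ) ^ 2 * (2 * Real.pi) + 4 * b ^ 2 * Real.pi := by
    simp only [hg]
    rw [intervalIntegral.integral_add
        ((by fun_prop : Continuous fun θ => 1 / (q : ℝ) ^ 2 + 4 * b / q * Real.cos θ
          ).intervalIntegrable _ _)
        ((by fun_prop : Continuous fun θ => 4 * b ^ 2 * Real.cos θ ^ 2).intervalIntegrable _ _),
      intervalIntegral.integral_add (by simp)
        ((by fun_prop : Continuous fun θ => 4 * b / q * Real.cos θ).intervalIntegrable _ _),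
      intervalIntegral.integral_const_mul, intervalIntegral.integral_const_mul, integral_cos,
      integral_cos_sq, intervalIntegral.integral_const]
    simp
    ring
  simp only [h1]
  rw [intervalIntegral.integral_add hfi (hgc.intervalIntegrable _ _), h2, h3, h4, ha]
  field_simp
  ring

/-- Cauchy–Schwarz against the constant function. -/
theorem sq_integral_le {μ : Measure ℂ} [IsFiniteMeasure μ] {f : ℂ → ℝ} (hf : Integrable f μ)
    (hf2 : Integrable (fun x => f x ^ 2) μ) :
    (∫ x, f x ∂μ) ^ 2 ≤ μ.real Set.univ * ∫ x, f x ^ 2 ∂μ := by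
  set m := μ.real Set.univ
  set I := ∫ x, f x ∂μ
  rcases measure_eq_zero_or_measureReal_univ_pos μ with h | h
  · simp [I, h]
  · have h1 : 0 ≤ ∫ x, (m * f x - I) ^ 2 ∂μ := integral_nonneg fun x => sq_nonneg _
    have h2 : ∫ x, (m * f x - I) ^ 2 ∂μ = m ^ 2 * ∫ x, f x ^ 2 ∂μ - m * I ^ 2 := by
      have : ∀ x, (m * f x - I) ^ 2 = m ^ 2 * f x ^ 2 - 2 * m * I * f x + I ^ 2 := fun x => by ring
      simp only [this]
      have hsub : Integrable (fun x => m ^ 2 * f x ^ 2 - 2 * m * I * f x) μ :=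
        (hf2.const_mul _).sub (hf.const_mul _)
      rw [integral_add hsub (integrable_const _), integral_sub (hf2.const_mul _) (hf.const_mul _), integral_const_mul, integral_const_mul,
        integral_const, smul_eq_mul]
      simp only [I]
      change _ + m * _ = _
      ring
    rw [h2] at h1
    nlinarith

theorem re_mul_conj_exp (w : ℂ) (θ : ℝ) :
    (w * (starRingEnd ℂ) (Circle.exp θ : ℂ)).re = ‖w‖ * Real.cos (θ - w.arg) := by
  rw [Circle.coe_exp, Complex.mul_re, Complex.conj_re, Complex.conj_im,
    Complex.exp_ofReal_mul_I_re, Complex.exp_ofReal_mul_I_im, Real.cos_sub,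
    ← Complex.norm_mul_cos_arg, ← Complex.norm_mul_sin_arg w]
  ring

theorem indicator_sub_dirCos_eq_arcResidual {q : ℕ} (hq : 1 ≤ q) (b θ : ℝ) {c x : ℂ}
    (hx : x ≠ c) :
    (regularSector q c (Circle.exp θ)).indicator (1 : ℂ → ℝ) x - 1 / q
      - 2 * b * dirCos c (Circle.exp θ) x = arcResidual q b (θ - (x - c).arg) := by
  have hpos : 0 < ‖x - c‖ := norm_pos_iff.2 (sub_ne_zero.2 hx)
  have h1 : dirCos c (Circle.exp θ) x = Real.cos (θ - (x - c).arg) := by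
    rw [dirCos, re_mul_conj_exp, mul_div_cancel_left₀ _ hpos.ne']
  have h2 : x ∈ regularSector q c (Circle.exp θ) ↔
      Real.cos (Real.pi / q) ≤ Real.cos (θ - (x - c).arg) := by
    rw [mem_regularSector_iff hq, re_mul_conj_exp, mul_le_mul_iff_right₀ hpos]
  rw [h1, arcResidual]
  by_cases h : Real.cos (Real.pi / q) ≤ Real.cos (θ - (x - c).arg)
  · rw [Set.indicator_of_mem (h2.2 h), if_pos h, Pi.one_apply]
  · rw [Set.indicator_of_notMem (mt h2.1 h), if_neg h]

/-- The deviation is the average over the mass of rotated copies of `arcResidual`. -/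
theorem sectorDeviation_eq_integral_arcResidual {q : ℕ} (hq : 1 ≤ q) {μ : Measure ℂ}
    (hμ : IsMass μ) {b : ℝ} {c : ℂ} (hb : ∀ e, b * ∫ x, dirCos c e x ∂μ = 0) (θ : ℝ) :
    sectorDeviation q μ c (Circle.exp θ) = ∫ x, arcResidual q b (θ - (x - c).arg) ∂μ := by
  have := hμ.finite
  have hS := (isClosed_regularSector hq c (Circle.exp θ)).measurableSet
  have hint : Integrable ((regularSector q c (Circle.exp θ)).indicator (1 : ℂ → ℝ)) μ :=
    (integrable_const (1 : ℝ)).indicator hS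
  have hsub : Integrable
      (fun x => (regularSector q c (Circle.exp θ)).indicator (1 : ℂ → ℝ) x - 1 / q) μ :=
    hint.sub (integrable_const _)
  rw [← integral_congr_ae ((hμ.ae_ne c).mono fun x hx => indicator_sub_dirCos_eq_arcResidual hq b θ hx),
    integral_sub hsub ((integrable_dirCos μ c _).const_mul _),
    integral_sub hint (integrable_const _), integral_indicator_one hS, integral_const_mul,
    mul_assoc, hb, sectorDeviation]
  simp [div_eq_mul_inv]

/-- The squared `L²`-norm of the deviation is at most that of `arcResidual`, by convexity.
The hypothesis holds for every `c` if `b = 0`, and for every `b` if `c` is a geometric median. -/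
theorem integral_sectorDeviation_sq_le {q : ℕ} (hq : 2 ≤ q) {μ : Measure ℂ} (hμ : IsMass μ)
    {b : ℝ} {c : ℂ} (hb : ∀ e, b * ∫ x, dirCos c e x ∂μ = 0) :
    ∫ θ in (-Real.pi)..Real.pi, sectorDeviation q μ c (Circle.exp θ) ^ 2 ≤
      μ.real Set.univ ^ 2 * (2 * Real.pi * (1 / (q : ℝ) - 1 / (q : ℝ) ^ 2
        - 4 * b * Real.sin (Real.pi / q) / Real.pi + 2 * b ^ 2)) := by
  have := hμ.finite
  have hpi := Real.pi_pos
  set m := μ.real Set.univ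
  set r : ℝ → ℂ → ℝ := fun θ x => arcResidual q b (θ - (x - c).arg) with hr
  have hrm : Measurable (Function.uncurry r) :=
    (measurable_arcResidual q b).comp
      (measurable_fst.sub (Complex.measurable_arg.comp (measurable_snd.sub_const c)))
  have hbd : ∀ θ x, |r θ x| ≤ 2 + 2 * |b| := fun θ x => abs_arcResidual_le _ _ _
  have hbd2 : ∀ θ x, ‖r θ x ^ 2‖ ≤ (2 + 2 * |b|) ^ 2 := fun θ x => by
    rw [norm_pow, Real.norm_eq_abs]
    gcongr
    exact hbd θ x
  have hi1 : ∀ θ, Integrable (r θ) μ := fun θ =>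
    Integrable.of_bound (hrm.comp measurable_prodMk_left).aestronglyMeasurable _
      (ae_of_all _ (hbd θ))
  have hi2 : ∀ θ, Integrable (fun x => r θ x ^ 2) μ := fun θ =>
    Integrable.of_bound ((hrm.comp measurable_prodMk_left).pow_const 2).aestronglyMeasurable _
      (ae_of_all _ (hbd2 θ))
  have hi3 : Integrable (Function.uncurry fun θ x => r θ x ^ 2)
      ((volume.restrict (Set.Ioc (-Real.pi) Real.pi)).prod μ) :=
    Integrable.of_bound (hrm.pow_const 2).aestronglyMeasurable _
      (ae_of_all _ fun p => hbd2 p.1 p.2)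
  have hcont : Continuous fun θ => sectorDeviation q μ c (Circle.exp θ) := by
    have := (continuous_measureReal_regularSector (by lia : 1 ≤ q) hμ).comp
      (by fun_prop : Continuous fun θ : ℝ => (c, Circle.exp θ))
    exact this.sub continuous_const
  have hle : (-Real.pi) ≤ Real.pi := by linarith
  calc ∫ θ in (-Real.pi)..Real.pi, sectorDeviation q μ c (Circle.exp θ) ^ 2
      ≤ ∫ θ in (-Real.pi)..Real.pi, m * ∫ x, r θ x ^ 2 ∂μ := by
        refine intervalIntegral.integral_mono hle
          ((hcont.pow 2).intervalIntegrable _ _) ?_ fun θ => ?_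
        · rw [intervalIntegrable_iff_integrableOn_Ioc_of_le hle]
          exact hi3.integral_prod_left.const_mul m
        · rw [sectorDeviation_eq_integral_arcResidual (by lia) hμ hb]
          exact sq_integral_le (hi1 θ) (hi2 θ)
    _ = m * ∫ x, (∫ θ in (-Real.pi)..Real.pi, r θ x ^ 2) ∂μ := by
        rw [intervalIntegral.integral_const_mul, intervalIntegral.integral_of_le hle,
          integral_integral_swap hi3]
        simp only [intervalIntegral.integral_of_le hle]
    _ = m * ∫ x : ℂ, 2 * Real.pi * (1 / (q : ℝ) - 1 / (q : ℝ) ^ 2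
          - 4 * b * Real.sin (Real.pi / q) / Real.pi + 2 * b ^ 2) ∂μ := by
        congr 2
        ext x
        have hper : Function.Periodic (fun θ => arcResidual q b θ ^ 2) (2 * Real.pi) :=
          (periodic_arcResidual q b).comp (· ^ 2)
        rw [← integral_arcResidual_sq hq b]
        simp only [hr]
        rw [intervalIntegral.integral_comp_sub_right (fun θ => arcResidual q b θ ^ 2)]
        have := hper.intervalIntegral_add_eq (-Real.pi - (x - c).arg) (-Real.pi)
        convert! this using 2 <;> ring
    _ = _ := by
        rw [integral_const, smul_eq_mul]
        ring

/-- From a centre at infinity the whole mass is seen in a single direction: the deviation tends to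
`μ (ℂ)` times a rotated copy of `arcResidual q 0`. -/
theorem tendsto_integral_sectorDeviation_sq {q : ℕ} (hq : 2 ≤ q) {μ : Measure ℂ} (hμ : IsMass μ) :
    Tendsto (fun c => ∫ θ in (-Real.pi)..Real.pi, sectorDeviation q μ c (Circle.exp θ) ^ 2)
      (cocompact ℂ) (𝓝 (μ.real Set.univ ^ 2 * (2 * Real.pi * (1 / (q : ℝ) - 1 / (q : ℝ) ^ 2)))) := by
  have := hμ.finite
  have hpi := Real.pi_pos
  have hq' : (2 : ℝ) ≤ q := by exact_mod_cast hq
  set a := Real.pi / q with ha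
  have ha0 : 0 ≤ a := by positivity
  have ha1 : a ≤ Real.pi / 2 := by rw [ha]; gcongr
  have hk0 : 0 ≤ Real.cos a := Real.cos_nonneg_of_mem_Icc ⟨by linarith, ha1⟩
  have hk1 : Real.cos a ≤ 1 := Real.cos_le_one a
  set m := μ.real Set.univ with hm
  have hm0 : 0 ≤ m := measureReal_nonneg
  -- The circle is parametrized by the angle `ψ` with the direction of `-c`, from the centre `c`
  -- towards the origin.
  have hshift : ∀ c, ∫ θ in (-Real.pi)..Real.pi, sectorDeviation q μ c (Circle.exp θ) ^ 2 =
      ∫ ψ in (-Real.pi)..Real.pi, sectorDeviation q μ c (Circle.exp (ψ + (-c).arg)) ^ 2 := by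
    intro c
    have hper : Function.Periodic (fun θ => sectorDeviation q μ c (Circle.exp θ) ^ 2)
        (2 * Real.pi) := fun θ => by simp only [Circle.periodic_exp θ]
    rw [intervalIntegral.integral_comp_add_right
      (fun θ => sectorDeviation q μ c (Circle.exp θ) ^ 2)]
    have := hper.intervalIntegral_add_eq (-Real.pi + (-c).arg) (-Real.pi)
    convert! this.symm using 2 <;> ring
  have hval : m ^ 2 * (2 * Real.pi * (1 / (q : ℝ) - 1 / (q : ℝ) ^ 2)) =
      ∫ ψ in (-Real.pi)..Real.pi, (m * arcResidual q 0 ψ) ^ 2 := by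
    simp only [mul_pow]
    rw [intervalIntegral.integral_const_mul, integral_arcResidual_sq hq]
    simp
  have hcg : (cocompact ℂ).IsCountablyGenerated := by
    rw [← Metric.cobounded_eq_cocompact, ← comap_norm_atTop]
    infer_instance
  simp only [hshift, hval]
  refine intervalIntegral.tendsto_integral_filter_of_dominated_convergence (fun _ => m ^ 2)
    (Eventually.of_forall fun c => ?_) (Eventually.of_forall fun c => ae_of_all _ fun ψ _ => ?_)
    (by simp) ?_
  · have h := (continuous_measureReal_regularSector (by lia : 1 ≤ q) hμ).comp
      (by fun_prop : Continuous fun ψ : ℝ => (c, Circle.exp (ψ + (-c).arg)))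
    exact ((h.sub continuous_const).pow 2).aestronglyMeasurable
  · rw [Real.norm_eq_abs, abs_pow]
    gcongr
    exact abs_sectorDeviation_le (by lia) μ c _
  have hnull : ∀ᵐ ψ : ℝ, ψ ∉ ({a, -a} : Set ℝ) :=
    measure_eq_zero_iff_ae_notMem.1 (Set.Finite.measure_zero (by simp) _)
  filter_upwards [hnull] with ψ hψ hψI
  rw [Set.uIoc_of_le (by linarith)] at hψI
  have hψne : Real.cos ψ ≠ Real.cos a := by
    intro h
    have h1 : |ψ| = a := by
      refine Real.injOn_cos ⟨abs_nonneg _, abs_le.2 ⟨hψI.1.le, hψI.2⟩⟩ ⟨ha0, by linarith⟩ ?_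
      rwa [Real.cos_abs]
    rcases abs_eq ha0 |>.1 h1 with h2 | h2 <;> simp [h2] at hψ
  -- Membership of a fixed point in the sector is decided by `ψ` alone once `c` is far away.
  have hmem : ∀ x : ℂ, ∀ᶠ c in cocompact ℂ,
      (x ∈ regularSector q c (Circle.exp (ψ + (-c).arg)) ↔ Real.cos a ≤ Real.cos ψ) := by
    intro x
    have hδ : 0 < |Real.cos ψ - Real.cos a| := abs_pos.2 (sub_ne_zero.2 hψne)
    filter_upwards [((tendsto_norm_cocompact_atTop (E := ℂ)).atTop_mul_const hδ).eventually_gt_atTop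
      (2 * ‖x‖)] with c hc
    have h1 : ((x - c) * (starRingEnd ℂ) (Circle.exp (ψ + (-c).arg) : ℂ)).re =
        (x * (starRingEnd ℂ) (Circle.exp (ψ + (-c).arg) : ℂ)).re + ‖c‖ * Real.cos ψ := by
      rw [sub_eq_add_neg, add_mul, Complex.add_re, re_mul_conj_exp (-c), norm_neg,
        add_sub_cancel_right]
    have h2 := abs_le.1
      (Complex.abs_re_le_norm (x * (starRingEnd ℂ) (Circle.exp (ψ + (-c).arg) : ℂ)))
    rw [norm_mul, RCLike.norm_conj, Circle.norm_coe, mul_one] at h2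
    have h3 := norm_sub_le x c
    have h4 := norm_sub_norm_le c x
    rw [norm_sub_rev] at h4
    have hx := norm_nonneg x
    rw [mem_regularSector_iff (by lia), h1]
    rcases lt_or_gt_of_ne hψne with h | h
    · rw [abs_of_neg (by linarith)] at hc
      refine iff_of_false (not_le_of_gt ?_) (not_le_of_gt h)
      nlinarith
    · rw [abs_of_pos (by linarith)] at hc
      refine iff_of_true ?_ h.le
      nlinarith
  refine Tendsto.pow ?_ 2
  have hlim : Tendsto (fun c => μ.real (regularSector q c (Circle.exp (ψ + (-c).arg))))
      (cocompact ℂ) (𝓝 (μ.real {_x | Real.cos a ≤ Real.cos ψ})) :=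
    (ENNReal.tendsto_toReal (measure_ne_top μ _)).comp
      (tendsto_measure_of_ae_tendsto_indicator_of_isFiniteMeasure _ (MeasurableSet.const _)
        (fun c => (isClosed_regularSector (by lia) _ _).measurableSet) (ae_of_all _ hmem))
  convert! hlim.sub_const (m / q) using 2
  rw [arcResidual]
  split_ifs with h
  · have : {_x : ℂ | Real.cos a ≤ Real.cos ψ} = Set.univ := Set.eq_univ_of_forall fun _ => h
    rw [this, ← hm]
    ring
  · have : {_x : ℂ | Real.cos a ≤ Real.cos ψ} = ∅ := Set.eq_empty_of_forall_notMem fun _ => h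
    rw [this, measureReal_empty]
    ring

theorem continuous_integral_sectorDeviation_sq {q : ℕ} (hq : 1 ≤ q) {μ : Measure ℂ}
    (hμ : IsMass μ) :
    Continuous fun c => ∫ θ in (-Real.pi)..Real.pi,
      sectorDeviation q μ c (Circle.exp θ) ^ 2 := by
  refine intervalIntegral.continuous_parametric_intervalIntegral_of_continuous' ?_ _ _
  have h := (continuous_measureReal_regularSector hq hμ).comp
    (by fun_prop : Continuous fun p : ℂ × ℝ => (p.1, Circle.exp p.2))
  exact (h.sub continuous_const).pow 2

/-- The `L²`-norm of the deviation attains its minimum: its limit at infinity is at the same time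
an upper bound for it. -/
theorem exists_forall_deviationL2Norm_le {q : ℕ} (hq : 2 ≤ q) {μ : Measure ℂ} (hμ : IsMass μ) :
    ∃ c₀, ∀ c, deviationL2Norm q μ c₀ ≤ deviationL2Norm q μ c := by
  have hpi := Real.pi_pos
  suffices h : ∃ c₀, ∀ c, (∫ θ in (-Real.pi)..Real.pi, sectorDeviation q μ c₀ (Circle.exp θ) ^ 2) ≤
      ∫ θ in (-Real.pi)..Real.pi, sectorDeviation q μ c (Circle.exp θ) ^ 2 by
    obtain ⟨c₀, h⟩ := h
    refine ⟨c₀, fun c => ?_⟩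
    unfold deviationL2Norm
    gcongr
    exact h c
  have hlim := tendsto_integral_sectorDeviation_sq hq hμ
  have hcont := continuous_integral_sectorDeviation_sq (by lia : 1 ≤ q) hμ
  have hle := fun c => integral_sectorDeviation_sq_le hq hμ (b := 0) (c := c) (by simp)
  simp only [mul_zero, zero_mul, zero_div, sub_zero, ne_eq, OfNat.ofNat_ne_zero, not_false_eq_true,
    zero_pow, add_zero] at hle
  by_cases h : ∃ c₁, ∫ θ in (-Real.pi)..Real.pi, sectorDeviation q μ c₁ (Circle.exp θ) ^ 2 <
      μ.real Set.univ ^ 2 * (2 * Real.pi * (1 / (q : ℝ) - 1 / (q : ℝ) ^ 2))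
  · obtain ⟨c₁, h⟩ := h
    exact hcont.exists_forall_le' c₁ ((hlim.eventually (lt_mem_nhds h)).mono fun _ => le_of_lt)
  · push Not at h
    exact ⟨0, fun c => (hle 0).trans (h c)⟩

/-! ### The constants -/

theorem one_div_pi_sq_bounds : 0.1013 < 1 / Real.pi ^ 2 ∧ 1 / Real.pi ^ 2 < 0.1014 := by
  have h1 := Real.pi_gt_d6
  have h2 := Real.pi_lt_d6
  constructor
  · rw [lt_div_iff₀ (by positivity)]
    nlinarith
  · rw [div_lt_iff₀ (by positivity)]
    nlinarith

/-- Comparison of the bound at the geometric median with the stated one. There is equality at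
`q = 2`; from `q = 6` on, Jordan's inequality `2 / q ≤ sin (π / q)` is sharp enough. -/
theorem variance_arcResidual_le {q : ℕ} (hq : 2 ≤ q) :
    1 / (q : ℝ) - 1 / (q : ℝ) ^ 2 - 2 * Real.sin (Real.pi / q) ^ 2 / Real.pi ^ 2 ≤
      1 / 3 - 2 / Real.pi ^ 2 - 1 / (3 * (q : ℝ) ^ 2) := by
  have hpi := Real.pi_pos
  obtain ⟨hp1, hp2⟩ := one_div_pi_sq_bounds
  have e1 : ∀ t : ℝ, t / Real.pi ^ 2 = t * (1 / Real.pi ^ 2) := fun t => by ring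
  rw [e1 2, e1]
  set p := 1 / Real.pi ^ 2
  have hbig : 6 ≤ q → 2 / (q : ℝ) ≤ Real.sin (Real.pi / q) := fun h => by
    have hq' : (6 : ℝ) ≤ q := by exact_mod_cast h
    have := Real.mul_le_sin (x := Real.pi / q) (by positivity) (by gcongr; linarith)
    convert! this using 1
    field_simp
  rcases (by lia : q = 2 ∨ q = 3 ∨ q = 4 ∨ q = 5 ∨ 6 ≤ q) with rfl | rfl | rfl | rfl | h
  · simp only [Nat.cast_ofNat, Real.sin_pi_div_two]
    linarith
  · have h3 : Real.sqrt 3 ^ 2 = 3 := Real.sq_sqrt (by norm_num)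
    simp only [Nat.cast_ofNat, Real.sin_pi_div_three, div_pow, h3]
    linarith
  · have h2 : Real.sqrt 2 ^ 2 = 2 := Real.sq_sqrt (by norm_num)
    simp only [Nat.cast_ofNat, Real.sin_pi_div_four, div_pow, h2]
    linarith
  · have h6 : 1 / 2 ≤ Real.sin (Real.pi / 5) := by
      rw [← Real.sin_pi_div_six]
      exact Real.sin_le_sin_of_le_of_le_pi_div_two (by linarith) (by linarith) (by linarith)
    have h7 : 1 / 4 ≤ Real.sin (Real.pi / 5) ^ 2 := by nlinarith
    simp only [Nat.cast_ofNat]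
    nlinarith
  · have hq' : (6 : ℝ) ≤ q := by exact_mod_cast h
    obtain ⟨s, hs⟩ : ∃ s, s = 1 / (q : ℝ) := ⟨_, rfl⟩
    have hs0 : 0 < s := by rw [hs]; positivity
    have hs1 : s ≤ 1 / 6 := by rw [hs]; gcongr
    have h1 : 2 * s ≤ Real.sin (Real.pi / q) := by
      rw [hs, mul_one_div]
      exact hbig h
    have h2 : 4 * s ^ 2 ≤ Real.sin (Real.pi / q) ^ 2 := by nlinarith
    have h3 : 1 / (3 * (q : ℝ) ^ 2) = s ^ 2 / 3 := by rw [hs]; field_simp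
    have h4 : 1 / (q : ℝ) ^ 2 = s ^ 2 := by rw [hs]; field_simp
    rw [h3, h4, ← hs]
    have h5 : 4 * s ^ 2 * 0.1013 ≤ Real.sin (Real.pi / q) ^ 2 * p := by gcongr
    nlinarith

theorem sqrt_lt_max {q : ℕ} (hq : q = 3 ∨ 6 < q) :
    √(1 / 3 - 2 / Real.pi ^ 2 - 1 / (3 * (q : ℝ) ^ 2)) <
      max (1 / (q : ℝ)) (((q : ℝ) - 2) / (2 * (q : ℝ))) := by
  obtain ⟨hp1, hp2⟩ := one_div_pi_sq_bounds
  have e1 : 2 / Real.pi ^ 2 = 2 * (1 / Real.pi ^ 2) := by ring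
  rw [e1]
  rcases hq with rfl | h
  · refine lt_max_of_lt_left ?_
    rw [Real.sqrt_lt' (by norm_num)]
    norm_num at hp1 ⊢
    linarith
  · refine lt_max_of_lt_right ?_
    have hq' : (7 : ℝ) ≤ q := by exact_mod_cast h
    obtain ⟨s, hs⟩ : ∃ s, s = 1 / (q : ℝ) := ⟨_, rfl⟩
    have hs0 : 0 < s := by rw [hs]; positivity
    have hs1 : s ≤ 1 / 7 := by rw [hs]; gcongr
    have h2 : ((q : ℝ) - 2) / (2 * q) = 1 / 2 - s := by rw [hs]; field_simp
    have h3 : 1 / (3 * (q : ℝ) ^ 2) = s ^ 2 / 3 := by rw [hs]; field_simp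
    rw [h2, h3, Real.sqrt_lt' (by linarith)]
    nlinarith

theorem sqrt_mem_admissibleL2 {q : ℕ} (hq : 2 ≤ q) :
    √(1 / 3 - 2 / Real.pi ^ 2 - 1 / (3 * (q : ℝ) ^ 2)) ∈ admissibleL2 q := by
  intro μ hμ
  have hpi := Real.pi_pos
  obtain ⟨c, hc⟩ := exists_integral_dirCos_eq_zero hμ
  refine ⟨c, ?_⟩
  have h1 := integral_sectorDeviation_sq_le hq hμ (b := Real.sin (Real.pi / q) / Real.pi)
    (c := c) (fun e => by rw [hc, mul_zero])
  have h2 := variance_arcResidual_le hq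
  have hm : 0 ≤ μ.real Set.univ := measureReal_nonneg
  set m := μ.real Set.univ
  rw [deviationL2Norm]
  calc _ ≤ √((1 / 3 - 2 / Real.pi ^ 2 - 1 / (3 * (q : ℝ) ^ 2)) * m ^ 2) := by
        refine Real.sqrt_le_sqrt ?_
        calc _ ≤ (2 * Real.pi)⁻¹ * _ := mul_le_mul_of_nonneg_left h1 (by positivity)
          _ = (1 / (q : ℝ) - 1 / (q : ℝ) ^ 2 - 2 * Real.sin (Real.pi / q) ^ 2 / Real.pi ^ 2)
              * m ^ 2 := by field_simp; ring
          _ ≤ _ := by gcongr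
    _ = _ := by rw [Real.sqrt_mul' _ (sq_nonneg m), Real.sqrt_sq hm]

theorem bddBelow_admissibleL2 (q : ℕ) : BddBelow (admissibleL2 q) := by
  refine ⟨0, fun ε hε => ?_⟩
  obtain ⟨c, hc⟩ := hε _ (isMass_volume_restrict (s := Metric.ball 0 1) measure_ball_lt_top.ne)
  have hpos : 0 < (volume.restrict (Metric.ball (0 : ℂ) 1)).real Set.univ := by
    rw [measureReal_restrict_apply MeasurableSet.univ, Set.univ_inter]
    exact ENNReal.toReal_pos (Metric.measure_ball_pos _ _ one_pos).ne' measure_ball_lt_top.ne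
  exact nonneg_of_mul_nonneg_left ((Real.sqrt_nonneg _).trans hc) hpos

theorem isLeast_admissibleL2 {q : ℕ} (hq : 2 ≤ q) : IsLeast (admissibleL2 q) (epsL2 q) := by
  refine ⟨fun μ hμ => ?_, fun ε hε => csInf_le (bddBelow_admissibleL2 q) hε⟩
  obtain ⟨c₀, hc₀⟩ := exists_forall_deviationL2Norm_le hq hμ
  refine ⟨c₀, ?_⟩
  have hle : ∀ ε ∈ admissibleL2 q, deviationL2Norm q μ c₀ ≤ ε * μ.real Set.univ := fun ε hε => by
    obtain ⟨c, hc⟩ := hε μ hμ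
    exact (hc₀ c).trans hc
  have := hμ.finite
  rcases measure_eq_zero_or_measureReal_univ_pos μ with rfl | hm
  · simpa using hle _ (sqrt_mem_admissibleL2 hq)
  · rw [← div_le_iff₀ hm]
    exact le_csInf ⟨_, sqrt_mem_admissibleL2 hq⟩ fun ε hε => (div_le_iff₀ hm).2 (hle ε hε)

theorem proposition2p1 :
    (∀ q : ℕ, 3 ≤ q →
      IsLeast (admissibleSup q) (epsSup q) ∧
      epsSup q = max (1 / (q : ℝ)) (((q : ℝ) - 2) / (2 * (q : ℝ)))) ∧
    (∀ q : ℕ, 2 ≤ q →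
      IsLeast (admissibleL2 q) (epsL2 q) ∧
      epsL2 q ≤ √(1 / 3 - 2 / Real.pi ^ 2 - 1 / (3 * (q : ℝ) ^ 2))) ∧
    (∀ q : ℕ, q = 3 ∨ 6 < q →
      √(1 / 3 - 2 / Real.pi ^ 2 - 1 / (3 * (q : ℝ) ^ 2)) < epsSup q) := by
  have heps : ∀ q : ℕ, 3 ≤ q →
      epsSup q = max (1 / (q : ℝ)) (((q : ℝ) - 2) / (2 * (q : ℝ))) := fun q hq =>
    (isLeast_admissibleSup hq).csInf_eq
  refine ⟨fun q hq => ⟨?_, heps q hq⟩, fun q hq => ⟨isLeast_admissibleL2 hq,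
    csInf_le (bddBelow_admissibleL2 q) (sqrt_mem_admissibleL2 hq)⟩, fun q hq => ?_⟩
  · rw [heps q hq]
    exact isLeast_admissibleSup hq
  · rw [heps q (by lia)]
    exact sqrt_lt_max hq
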